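/- \textbf{Setting.} Let $d,q\ge 0$ and $K\ge 2$ be integers. The signal $U_n\in\mathbb R^d$ and the observations $Z_n\in\mathbb R^q$ satisfy $$U_n=\Psi(U_{n-1})+\zeta_n,\qquad Z_n=HU_n+\xi_n ,$$ where $\Psi:\mathbb R^d\to\mathbb R^d$ is measurable; the conditional law of $\zeta_n$ given $U_{n-1}=u$ is $Q(u,\cdot)$, a Markov kernel such that each $Q(u,\cdot)$ has mean zero and a finite covariance matrix $R(u)$; $H\in\mathbb R^{q\times d}$ has rank $q$; and the $\xi_n$ are i.i.d., independent of all the other variables, with mean zero and covariance $I_q$. The ETKF ensemble $(V_n^{(1)},\dots,V_n^{(K)})$ evolves as follows. \emph{Forecast:} $\widehat V^{(k)}_n=\Psi(V^{(k)}_{n-1})+\zeta^{(k)}_n$, where, given the past, $\zeta_n,\zeta_n^{(1)},\dots,\zeta_n^{(K)}$ are independent and $\zeta^{(k)}_n\sim Q(V^{(k)}_{n-1},\cdot)$. Let $\overline{\widehat V}_n=\frac1K\sum_k\widehat V_n^{(k)}$, let $\widehat S_n$ be the $d\times K$ matrix with columns $\widehat V_n^{(k)}-\overline{\widehat V}_n$,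 and let $\widehat C_n=(K-1)^{-1}\widehat S_n\widehat S_n^T$. \emph{Analysis:} $$V^{(k)}_n=\overline{\widehat V}_n-\widehat C_nH^T(I+H\widehat C_nH^T)^{-1}\bigl(H\overline{\widehat V}_n-Z_n\bigr)+S_n^{(k)},$$ where $S_n^{(k)}$ is the $k$-th column of $S_n=\widehat S_nT(\widehat S_n)$ and $T(\widehat S)=\bigl(I_K+(K-1)^{-1}\widehat S^TH^TH\widehat S\bigr)^{-1/2}$ is the symmetric (spectral) inverse square root. Let $P$ be the transition kernel of the Markov chain $X_n=(U_n,V_n^{(1)},\dots,V_n^{(K)})$ on $\mathbb R^d\times\mathbb R^{d\times K}$ (the ETKF signal-ensemble process). \textbf{Assumptions.} \begin{enumerate} \item (Kinetic energy principle) There are $\beta\in(0,1)$ and $c>0$ with $|\Psi(u)|^2+\operatorname{tr}R(u)\le(1-\beta)|u|^2+c$ for all $u\in\mathbb R^d$. \item (Nondegenerate system noise) For all $M_1,M_2>0$ there is $\alpha>0$ such that $Q(u,A)\ge\alpha\,\lambda(A\cap\{|z|\le M_2\})$ for all $|u|\le M_1$ and all Borel sets $A$, where $\lambda$ is Lebesgue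 measure. \item (Strong Lyapunov function) $\mathcal E:\mathbb R^d\times\mathbb R^{d\times K}\to[0,\infty)$ has compact sublevel sets, and there are $\beta',c'>0$ such that for all $x$ the function $\mathcal E$ is $P(x,\cdot)$-integrable and $\int\mathcal E\,dP(x,\cdot)\le(1-\beta')\mathcal E(x)+c'$. \end{enumerate} \textbf{Theorem.} Under these assumptions the ETKF signal-ensemble process is geometrically ergodic in total variation: $P$ has a unique invariant probability measure $\pi$, and there are $r\in(0,1)$ and $\kappa>0$ such that for every initial probability law $\mu$, writing $P^n\mu$ for the law of $X_n$ when $X_0\sim\mu$, $$\|P^n\mu-\pi\|_{TV}\le\kappa\,r^n\Bigl(1+\int\mathcal E\,d\mu\Bigr)\qquad(n\ge0).$$ Moreover, with the same $r$, for all probability laws $\mu,\nu$ for which $\mathcal E$ is integrable there is a constant $C_{\mu,\nu}$ with $\|P^n\mu-P^n\nu\|_{TV}\le C_{\mu,\nu}\,r^n$ for all $n\ge0$; and $\|P^n\mu-\pi\|_{TV}\to0$ for every probability law $\mu$. -/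

import Mathlib

open MeasureTheory ProbabilityTheory
open scoped ENNReal

namespace EnsembleFilter

noncomputable section

/-- The data of the filtering problem
`U_n = Ψ(U_{n-1}) + ζ_n`, `Z_n = H U_n + ξ_n`, with signal dimension `d` and observation
dimension `q`.  The kernel `noise u` is the conditional law of `ζ_n` given `U_{n-1} = u`, and
`obsNoise` is the common law of the i.i.d. observation noises `ξ_n`. -/
structure FilterModel (d q : ℕ) where
  Ψ : EuclideanSpace ℝ (Fin d) → EuclideanSpace ℝ (Fin d)
  measurable_Ψ : Measurable Ψ
  noise : Kernel (EuclideanSpace ℝ (Fin d)) (EuclideanSpace ℝ (Fin d))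
  isMarkovKernel_noise : IsMarkovKernel noise
  memLp_noise : ∀ u, MemLp id 2 (noise u)
  mean_noise : ∀ u, ∫ z, z ∂(noise u) = 0
  H : Matrix (Fin q) (Fin d) ℝ
  rank_H : H.rank = q
  obsNoise : Measure (EuclideanSpace ℝ (Fin q))
  isProbabilityMeasure_obsNoise : IsProbabilityMeasure obsNoise
  memLp_obsNoise : MemLp id 2 obsNoise
  mean_obsNoise : ∫ z, z ∂obsNoise = 0
  cov_obsNoise : ∀ i j, ∫ z, z i * z j ∂obsNoise = (1 : Matrix (Fin q) (Fin q) ℝ) i j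

/-- The state space `ℝ^d × ℝ^{d × K}` of the signal-ensemble process. -/
abbrev State (d K : ℕ) : Type :=
  EuclideanSpace ℝ (Fin d) × (Fin K → EuclideanSpace ℝ (Fin d))

/-! ### The analysis step of the ETKF -/

section Update

variable {d q K : ℕ}

/-- The ensemble mean. -/
def ensMean (V : Fin K → EuclideanSpace ℝ (Fin d)) : EuclideanSpace ℝ (Fin d) :=
  (K : ℝ)⁻¹ • ∑ k, V k

/-- The `d × K` spread matrix, with columns `V^{(k)} - V̄`. -/
def spread (V : Fin K → EuclideanSpace ℝ (Fin d)) : Matrix (Fin d) (Fin K) ℝ :=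
  Matrix.of fun i k => V k i - ensMean V i

/-- The ensemble covariance `(K-1)⁻¹ ∑_k (V^{(k)} - V̄) ⊗ (V^{(k)} - V̄)`. -/
def ensCov (V : Fin K → EuclideanSpace ℝ (Fin d)) : Matrix (Fin d) (Fin d) ℝ :=
  Matrix.of fun i j =>
    ((K : ℝ) - 1)⁻¹ * ∑ k, (V k i - ensMean V i) * (V k j - ensMean V j)

/-- The Kalman gain `C Hᵀ (I + H C Hᵀ)⁻¹`. -/
def gain (H : Matrix (Fin q) (Fin d) ℝ) (C : Matrix (Fin d) (Fin d) ℝ) :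
    Matrix (Fin d) (Fin q) ℝ :=
  C * H.transpose * (1 + H * C * H.transpose)⁻¹

/-- The argument `I + (K-1)⁻¹ Sᵀ Hᵀ H S` of the inverse square root. -/
def transformArg (H : Matrix (Fin q) (Fin d) ℝ) (S : Matrix (Fin d) (Fin K) ℝ) :
    Matrix (Fin K) (Fin K) ℝ :=
  1 + ((K : ℝ) - 1)⁻¹ • (S.transpose * H.transpose * H * S)

/-- The symmetric transform matrix `T(S) = (I + (K-1)⁻¹ Sᵀ Hᵀ H S)^{-1/2}`, the power being
taken in the spectral functional calculus of real symmetric matrices. -/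
def transform (H : Matrix (Fin q) (Fin d) ℝ) (S : Matrix (Fin d) (Fin K) ℝ) :
    Matrix (Fin K) (Fin K) ℝ :=
  cfc (fun t : ℝ => t ^ (-(1 / 2) : ℝ)) (transformArg H S)

/-- The posterior mean `V̄ - C Hᵀ (I + H C Hᵀ)⁻¹ (H V̄ - Z)`. -/
def postMean (H : Matrix (Fin q) (Fin d) ℝ) (V : Fin K → EuclideanSpace ℝ (Fin d))
    (Z : EuclideanSpace ℝ (Fin q)) : EuclideanSpace ℝ (Fin d) :=
  ensMean V - (gain H (ensCov V)).toEuclideanLin (H.toEuclideanLin (ensMean V) - Z)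

/-- The ETKF update map `(U, V, Z) ↦ (U, Γ^{(1)}, …, Γ^{(K)})`, where `Γ^{(k)}` is the posterior
mean plus the `k`-th column of `S T(S)`, `S` being the spread matrix of the forecast
ensemble `V`. -/
def etkfUpdate (H : Matrix (Fin q) (Fin d) ℝ) (y : State d K × EuclideanSpace ℝ (Fin q)) :
    State d K :=
  (y.1.1, fun k => postMean H y.1.2 y.2 +
    WithLp.toLp 2 (fun i => (spread y.1.2 * transform H (spread y.1.2)) i k))

end Update

/-! ### Measurability of the update map -/

section Measurability

variable {d q K : ℕ}

lemma continuous_ensMean :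
    Continuous (ensMean : (Fin K → EuclideanSpace ℝ (Fin d)) → EuclideanSpace ℝ (Fin d)) := by
  unfold ensMean
  fun_prop

lemma continuous_spread :
    Continuous (spread : (Fin K → EuclideanSpace ℝ (Fin d)) → Matrix (Fin d) (Fin K) ℝ) := by
  refine continuous_matrix fun i k => ?_
  have := continuous_ensMean (d := d) (K := K)
  simp only [spread, Matrix.of_apply]
  fun_prop

lemma continuous_ensCov :
    Continuous (ensCov : (Fin K → EuclideanSpace ℝ (Fin d)) → Matrix (Fin d) (Fin d) ℝ) := by
  refine continuous_matrix fun i k => ?_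
  have := continuous_ensMean (d := d) (K := K)
  simp only [ensCov, Matrix.of_apply]
  fun_prop

lemma measurable_gain (H : Matrix (Fin q) (Fin d) ℝ) {α : Type*} [MeasurableSpace α]
    [TopologicalSpace α] [BorelSpace α] {C : α → Matrix (Fin d) (Fin d) ℝ}
    (hC : Continuous C) (i : Fin d) (j : Fin q) :
    Measurable fun a => gain H (C a) i j := by
  have h1 : Continuous fun a => 1 + H * C a * H.transpose := by fun_prop
  have h2 : ∀ a, gain H (C a) i j =
      (1 + H * C a * H.transpose).det⁻¹ *
        (C a * H.transpose * (1 + H * C a * H.transpose).adjugate) i j := by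
    intro a
    simp [gain, Matrix.inv_def]
  simp_rw [h2]
  refine Measurable.mul (h1.matrix_det.measurable.inv) ?_
  refine Continuous.measurable ?_
  have h3 := h1.matrix_adjugate
  have h4 : Continuous fun a => C a * H.transpose * (1 + H * C a * H.transpose).adjugate := by
    fun_prop
  exact h4.matrix_elem i j

lemma posSemidef_transformArg_sub_one (hK : 1 ≤ K) (H : Matrix (Fin q) (Fin d) ℝ)
    (S : Matrix (Fin d) (Fin K) ℝ) : (transformArg H S - 1).PosSemidef := by
  have h : transformArg H S - 1 = ((K : ℝ) - 1)⁻¹ • ((H * S).conjTranspose * (H * S)) := by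
    simp [transformArg, Matrix.mul_assoc, Matrix.conjTranspose_eq_transpose_of_trivial]
  rw [h]
  refine (Matrix.posSemidef_conjTranspose_mul_self _).smul ?_
  have : (1 : ℝ) ≤ K := by exact_mod_cast hK
  exact inv_nonneg.2 (by linarith)

open scoped Matrix.Norms.L2Operator MatrixOrder in
lemma continuous_transform (H : Matrix (Fin q) (Fin d) ℝ) :
    Continuous (transform H : Matrix (Fin d) (Fin K) ℝ → Matrix (Fin K) (Fin K) ℝ) := by
  rcases Nat.eq_zero_or_pos K with rfl | hK
  · exact continuous_of_const fun _ _ => Subsingleton.elim _ _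
  have harg : Continuous (transformArg H :
      Matrix (Fin d) (Fin K) ℝ → Matrix (Fin K) (Fin K) ℝ) := by
    unfold transformArg
    fun_prop
  have hpd : ∀ S, (transformArg (K := K) H S).PosDef := fun S => by
    have h := Matrix.PosDef.one.add_posSemidef (posSemidef_transformArg_sub_one hK H S)
    simpa using h
  refine Continuous.cfc_of_mem_nhdsSet (s := Set.Ioi 0) _ ?_ harg
    (fun S => (hpd S).isHermitian) ?_
  · refine isOpen_Ioi.mem_nhdsSet.2 (Set.iUnion_subset fun S t ht => ?_)
    rw [(hpd S).isHermitian.spectrum_real_eq_range_eigenvalues] at ht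
    obtain ⟨i, rfl⟩ := ht
    exact (hpd S).eigenvalues_pos i
  · exact fun t ht => (Real.continuousAt_rpow_const t _ (Or.inl (ne_of_gt ht))).continuousWithinAt

lemma measurable_etkfUpdate (H : Matrix (Fin q) (Fin d) ℝ) :
    Measurable (etkfUpdate H : State d K × EuclideanSpace ℝ (Fin q) → State d K) := by
  have hm := continuous_ensMean (d := d) (K := K)
  have hs := continuous_spread (d := d) (K := K)
  have ht : Continuous fun V : Fin K → EuclideanSpace ℝ (Fin d) =>
      spread V * transform H (spread V) :=
    hs.matrix_mul ((continuous_transform H).comp hs)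
  refine Measurable.prodMk (by fun_prop) (measurable_pi_lambda _ fun k => ?_)
  refine Measurable.add ?_ ?_
  · unfold postMean
    refine Measurable.sub (hm.measurable.comp (by fun_prop)) ?_
    refine (WithLp.measurable_toLp 2 _).comp (measurable_pi_lambda _ fun i => ?_)
    change Measurable fun y : State d K × EuclideanSpace ℝ (Fin q) =>
      ∑ j, gain H (ensCov y.1.2) i j * (Matrix.toEuclideanLin H (ensMean y.1.2) - y.2) j
    refine Finset.measurable_sum _ fun j _ => Measurable.mul ?_ ?_
    · exact (measurable_gain H (continuous_ensCov (d := d) (K := K)) i j).comp (by fun_prop)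
    · have h : Continuous fun y : State d K × EuclideanSpace ℝ (Fin q) =>
          Matrix.toEuclideanLin H (ensMean y.1.2) - y.2 :=
        ((Matrix.toEuclideanLin H).continuous_of_finiteDimensional.comp
          (hm.comp (continuous_snd.comp continuous_fst))).sub continuous_snd
      exact ((continuous_apply j).comp ((PiLp.continuous_ofLp 2 _).comp h)).measurable
  · refine (WithLp.measurable_toLp 2 _).comp (measurable_pi_lambda _ fun i => ?_)
    exact ((ht.matrix_elem i k).measurable).comp (by fun_prop)

end Measurability

/-! ### The transition kernel of the signal-ensemble process -/

/-- The kernel `v ↦ κ(v_1) ⊗ ⋯ ⊗ κ(v_K)`: independent draws for the individual members. -/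
def ensembleKernel {E F : Type*} [MeasurableSpace E] [MeasurableSpace F] (κ : Kernel E F)
    [IsMarkovKernel κ] (K : ℕ) : Kernel (Fin K → E) (Fin K → F) where
  toFun v := Measure.pi fun k => κ (v k)
  measurable' := by
    refine Measurable.measure_of_isPiSystem_of_isProbabilityMeasure
      generateFrom_pi.symm isPiSystem_pi ?_
    rintro _ ⟨s, hs, rfl⟩
    simp only [Measure.pi_pi]
    refine Finset.measurable_prod _ fun k _ => ?_
    exact (κ.measurable_coe (hs k (Set.mem_univ k))).comp (measurable_pi_apply k)

instance {E F : Type*} [MeasurableSpace E] [MeasurableSpace F] (κ : Kernel E F)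
    [IsMarkovKernel κ] (K : ℕ) : IsMarkovKernel (ensembleKernel κ K) :=
  ⟨fun v => inferInstanceAs (IsProbabilityMeasure (Measure.pi fun k => κ (v k)))⟩

namespace FilterModel

variable {d q : ℕ} (M : FilterModel d q)

instance : IsMarkovKernel M.noise := M.isMarkovKernel_noise

instance : IsProbabilityMeasure M.obsNoise := M.isProbabilityMeasure_obsNoise

/-- The transition kernel of the signal: the law of `Ψ(u) + ζ` with `ζ` drawn from `noise u`. -/
def signalKernel : Kernel (EuclideanSpace ℝ (Fin d)) (EuclideanSpace ℝ (Fin d)) :=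
  (Kernel.deterministic M.Ψ M.measurable_Ψ ×ₖ M.noise).map fun p => p.1 + p.2

instance : IsMarkovKernel M.signalKernel :=
  Kernel.IsMarkovKernel.map _ (by fun_prop)

/-- The kernel `(U_{n-1}, V_{n-1}) ↦ (U_n, V̂_n, Z_n)`: the signal and all ensemble members are
propagated with independent noises, and `Z_n = H U_n + ξ_n` with an independent `ξ_n`. -/
def forecastKernel (K : ℕ) :
    Kernel (State d K) (State d K × EuclideanSpace ℝ (Fin q)) :=
  ((M.signalKernel ∥ₖ ensembleKernel M.signalKernel K) ×ₖ Kernel.const _ M.obsNoise).map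
    fun p => (p.1, M.H.toEuclideanLin p.1.1 + p.2)

instance (K : ℕ) : IsMarkovKernel (M.forecastKernel K) :=
  Kernel.IsMarkovKernel.map _ (by fun_prop)

/-- The transition kernel of the ETKF signal-ensemble process
`(U_n, V_n^{(1)}, …, V_n^{(K)})`. -/
def etkfKernel (K : ℕ) : Kernel (State d K) (State d K) :=
  (M.forecastKernel K).map (etkfUpdate M.H)

instance (K : ℕ) : IsMarkovKernel (M.etkfKernel K) :=
  Kernel.IsMarkovKernel.map _ (measurable_etkfUpdate M.H)

/-! ### The assumptions -/

/-- The conditional covariance `R(u) = E(ζ_n ⊗ ζ_n | U_{n-1} = u)` of the system noise. -/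
def noiseCov (u : EuclideanSpace ℝ (Fin d)) : Matrix (Fin d) (Fin d) ℝ :=
  Matrix.of fun i j => ∫ z, z i * z j ∂(M.noise u)

/-- The kinetic energy principle. -/
def KineticEnergyPrinciple : Prop :=
  ∃ β c : ℝ, 0 < β ∧ β < 1 ∧ 0 < c ∧
    ∀ u, ‖M.Ψ u‖ ^ 2 + (M.noiseCov u).trace ≤ (1 - β) * ‖u‖ ^ 2 + c

/-- Nondegenerate system noise: on bounded sets of states, the law of the noise dominates a
multiple of Lebesgue measure on any given ball. -/
def NondegenerateNoise : Prop :=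
  ∀ M₁ M₂ : ℝ, 0 < M₁ → 0 < M₂ → ∃ α : ℝ, 0 < α ∧
    ∀ u : EuclideanSpace ℝ (Fin d), ‖u‖ ≤ M₁ →
      ENNReal.ofReal α • (volume.restrict (Metric.closedBall 0 M₂)) ≤ M.noise u

end FilterModel

/-- `𝓔` is a strong Lyapunov function for the Markov chain with transition kernel `P`: it is
nonnegative, has compact sublevel sets, and satisfies
`E_{n-1} 𝓔(X_n) ≤ (1 - β) 𝓔(X_{n-1}) + c`. -/
def IsStrongLyapunov {X : Type*} [MeasurableSpace X] [TopologicalSpace X] (P : Kernel X X)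
    (𝓔 : X → ℝ) : Prop :=
  (∀ x, 0 ≤ 𝓔 x) ∧ (∀ a : ℝ, IsCompact {x | 𝓔 x ≤ a}) ∧
    ∃ β c : ℝ, 0 < β ∧ 0 < c ∧
      ∀ x, Integrable 𝓔 (P x) ∧ ∫ y, 𝓔 y ∂(P x) ≤ (1 - β) * 𝓔 x + c

/-! ### Geometric ergodicity -/

instance isMarkovKernel_pow {X : Type*} [MeasurableSpace X] (P : Kernel X X) [IsMarkovKernel P]
    (n : ℕ) : IsMarkovKernel (P ^ n) := by
  induction n with
  | zero => exact inferInstanceAs (IsMarkovKernel (Kernel.id : Kernel X X))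
  | succ n ih =>
    rw [pow_succ]
    exact inferInstanceAs (IsMarkovKernel ((P ^ n) ∘ₖ P))

/-- The total variation norm `‖μ - ν‖_TV`, as an extended nonnegative number. -/
def tvNorm {X : Type*} [MeasurableSpace X] (μ ν : Measure X) [IsFiniteMeasure μ]
    [IsFiniteMeasure ν] : ℝ≥0∞ :=
  (μ.toSignedMeasure - ν.toSignedMeasure).totalVariation Set.univ

/-- Geometric ergodicity of the chain with kernel `P`, with initial laws weighted by `𝓔`: there
is a unique invariant probability measure `π`; the law `P ^ n ∘ₘ μ` of `X_n` started
from `μ` approaches `π` at a geometric rate, and any two such laws with finite `𝓔`-moment approach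
each other at the same rate; finally `π` attracts every initial law. -/
def GeometricallyErgodic {X : Type*} [MeasurableSpace X] (P : Kernel X X) [IsMarkovKernel P]
    (𝓔 : X → ℝ) : Prop :=
  ∃ (π : Measure X) (_ : IsProbabilityMeasure π),
    P.Invariant π ∧
    (∀ π' : Measure X, IsProbabilityMeasure π' → P.Invariant π' → π' = π) ∧
    (∃ r κ : ℝ, 0 < r ∧ r < 1 ∧ 0 < κ ∧
      (∀ (μ : Measure X) [IsProbabilityMeasure μ] (n : ℕ),
        tvNorm ((P ^ n : Kernel X X) ∘ₘ μ) π ≤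
          ENNReal.ofReal (κ * r ^ n) * (1 + ∫⁻ x, ENNReal.ofReal (𝓔 x) ∂μ)) ∧
      (∀ (μ ν : Measure X) [IsProbabilityMeasure μ] [IsProbabilityMeasure ν],
        Integrable 𝓔 μ → Integrable 𝓔 ν → ∃ C : ℝ, 0 < C ∧
          ∀ n : ℕ, tvNorm ((P ^ n : Kernel X X) ∘ₘ μ) ((P ^ n : Kernel X X) ∘ₘ ν) ≤ ENNReal.ofReal (C * r ^ n))) ∧
    (∀ (μ : Measure X) [IsProbabilityMeasure μ],
      Filter.Tendsto (fun n : ℕ => tvNorm ((P ^ n : Kernel X X) ∘ₘ μ) π) Filter.atTop (nhds 0))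

end

end EnsembleFilter

open EnsembleFilter

/-!
The proof is an application of Harris' theorem: a Lyapunov function together with a one-step
minorization on its sublevel sets implies geometric ergodicity.

The minorization (`exists_le_etkfKernel`) needs no information about the analysis step beyond its
measurability. A sublevel set of `𝓔` is compact, hence bounded, and the kinetic energy principle
bounds `Ψ` on bounded sets. Nondegeneracy of the noise then gives a fixed multiple of Lebesgue
measure on the unit ball that lies below the law of `Ψ u + ζ` for every `u` in a bounded set
(`exists_le_signalKernel`). By independence the joint law of the signal, the forecast ensemble and
the observation noise lies above a fixed nonzero product measure, and the transition kernel lies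
above the image of that measure under the update map.

Harris' theorem (`geometricallyErgodic_of_drift_of_minorization`) is proved by the method of
Hairer and Mattingly. For a suitable `b > 0`, one step of the chain contracts the oscillation of
functions relative to the weight `2 + b V x + b V y`
(`abs_integral_sub_integral_le_contraction`). Applied to indicator functions this shows that the
numbers `P ^ n x A` are Cauchy in `n`, uniformly in the measurable set `A`, and have limits that do
not depend on `x`. The limits form a probability measure
(`exists_isProbabilityMeasure_abs_real_sub_le`), which is the invariant one. The resulting pointwise
bound `min 1 (κ r ^ n (1 + V x))` on `|P ^ n x A - π A|` is integrated against the initial law: this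
gives the geometric rates, and by dominated convergence the convergence from every initial law.
-/

namespace EnsembleFilter

open Filter Topology

/-! ### Setwise estimates between measures -/

section SetwiseEstimates

variable {X : Type*} [MeasurableSpace X]

/-- The total variation norm is at most twice the largest discrepancy on a measurable set: its
positive and negative parts are attained on the two halves of a Hahn decomposition. -/
lemma tvNorm_le_of_forall_abs_real_sub_le {μ ν : Measure X} [IsFiniteMeasure μ]
    [IsFiniteMeasure ν] {ε : ℝ}
    (h : ∀ A, MeasurableSet A → |μ.real A - ν.real A| ≤ ε) :
    tvNorm μ ν ≤ ENNReal.ofReal (2 * ε) := by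
  have key : ∀ A, MeasurableSet A →
      (μ.toSignedMeasure - ν.toSignedMeasure) A = μ.real A - ν.real A := fun A hA => by
    simp [Measure.toSignedMeasure_apply_measurable hA]
  set s := μ.toSignedMeasure - ν.toSignedMeasure with hs
  obtain ⟨i, hi, hpos, hneg, h1, h2⟩ := s.toJordanDecomposition_spec
  have e1 : s.toJordanDecomposition.posPart Set.univ ≤ ENNReal.ofReal ε := by
    rw [← ofReal_measureReal, h1, SignedMeasure.toMeasureOfZeroLE_real_apply _ hpos hi .univ,
      Set.inter_univ, key i hi]
    exact ENNReal.ofReal_le_ofReal ((le_abs_self _).trans (h i hi))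
  have e2 : s.toJordanDecomposition.negPart Set.univ ≤ ENNReal.ofReal ε := by
    rw [← ofReal_measureReal, h2,
      SignedMeasure.toMeasureOfLEZero_real_apply _ hneg hi.compl .univ,
      Set.inter_univ, key _ hi.compl]
    exact ENNReal.ofReal_le_ofReal ((neg_le_abs _).trans (h _ hi.compl))
  have hε : 0 ≤ ε := (abs_nonneg _).trans (h ∅ .empty)
  calc tvNorm μ ν = s.toJordanDecomposition.posPart Set.univ
        + s.toJordanDecomposition.negPart Set.univ := rfl
    _ ≤ ENNReal.ofReal ε + ENNReal.ofReal ε := add_le_add e1 e2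
    _ = ENNReal.ofReal (2 * ε) := by rw [← ENNReal.ofReal_add hε hε, two_mul]

/-- By the layer cake formula, a bound on the discrepancy of two measures on sets is a bound on
the discrepancy of the integrals of `[0, 1]`-valued functions. -/
lemma abs_integral_sub_integral_le {μ ν : Measure X} [IsFiniteMeasure μ] [IsFiniteMeasure ν]
    {ε : ℝ} (h : ∀ A, MeasurableSet A → |μ.real A - ν.real A| ≤ ε) {f : X → ℝ}
    (hf : Measurable f) (h0 : ∀ x, 0 ≤ f x) (h1 : ∀ x, f x ≤ 1) :
    |∫ x, f x ∂μ - ∫ x, f x ∂ν| ≤ ε := by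
  have hint : ∀ (η : Measure X) [IsFiniteMeasure η], Integrable f η := fun η _ =>
    Integrable.of_bound hf.aestronglyMeasurable 1
      (ae_of_all _ fun x => by rw [Real.norm_eq_abs, abs_of_nonneg (h0 x)]; exact h1 x)
  have hlev : ∀ (η : Measure X) [IsFiniteMeasure η],
      IntegrableOn (fun t : ℝ => η.real {x | t ≤ f x}) (Set.Ioc 0 1) := fun η _ => by
    have hanti : Antitone fun t : ℝ => η.real {x | t ≤ f x} := fun s t hst =>
      measureReal_mono fun x (hx : t ≤ f x) => hst.trans hx
    exact (hanti.antitoneOn _).integrableOn_isCompact (isCompact_Icc (a := 0) (b := 1))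
      |>.mono_set Set.Ioc_subset_Icc_self
  rw [(hint μ).integral_eq_integral_Ioc_meas_le (ae_of_all _ h0) (ae_of_all _ h1),
    (hint ν).integral_eq_integral_Ioc_meas_le (ae_of_all _ h0) (ae_of_all _ h1),
    ← integral_sub (hlev μ) (hlev ν)]
  have := norm_setIntegral_le_of_norm_le_const (μ := volume) (s := Set.Ioc (0 : ℝ) 1)
    (f := fun t => μ.real {x | t ≤ f x} - ν.real {x | t ≤ f x}) (C := ε) (by simp)
    (fun t _ => h _ (measurableSet_le measurable_const hf))
  simpa using this

/-- Completeness of the probability measures for setwise convergence that is uniform over the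
measurable sets. -/
lemma exists_isProbabilityMeasure_abs_real_sub_le (μ : ℕ → Measure X)
    [∀ n, IsProbabilityMeasure (μ n)] {ε : ℕ → ℝ} (hε : Tendsto ε atTop (𝓝 0))
    (h : ∀ n m A, MeasurableSet A → |(μ n).real A - (μ (n + m)).real A| ≤ ε n) :
    ∃ π : Measure X, IsProbabilityMeasure π ∧
      ∀ n A, MeasurableSet A → |(μ n).real A - π.real A| ≤ ε n := by
  have hlim : ∀ A, ∃ l : ℝ, MeasurableSet A → Tendsto (fun n => (μ n).real A) atTop (𝓝 l) := by
    intro A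
    by_cases hA : MeasurableSet A
    · have hc : CauchySeq fun n => (μ n).real A := by
        refine cauchySeq_of_le_tendsto_0' ε (fun n m hnm => ?_) hε
        obtain ⟨k, rfl⟩ := Nat.exists_eq_add_of_le hnm
        exact h n k A hA
      exact (cauchySeq_tendsto_of_complete hc).imp fun l hl _ => hl
    · exact ⟨0, fun h => absurd h hA⟩
  choose L hL using hlim
  have hbound : ∀ n A, MeasurableSet A → |(μ n).real A - L A| ≤ ε n := fun n A hA => by
    have h1 : Tendsto (fun m => |(μ n).real A - (μ (n + m)).real A|) atTop
        (𝓝 |(μ n).real A - L A|) := by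
      refine (tendsto_const_nhds.sub ((hL A hA).comp ?_)).abs
      exact tendsto_atTop_mono (fun m => Nat.le_add_left m n) tendsto_id
    exact le_of_tendsto h1 (Eventually.of_forall fun m => h n m A hA)
  have hnonneg : ∀ A, MeasurableSet A → 0 ≤ L A := fun A hA =>
    ge_of_tendsto' (hL A hA) fun n => measureReal_nonneg
  have hempty : L ∅ = 0 :=
    tendsto_nhds_unique (hL ∅ .empty) (by simp)
  have huniv : L Set.univ = 1 :=
    tendsto_nhds_unique (hL _ .univ) (by simp)
  have hfin : ∀ (f : ℕ → Set X), (∀ i, MeasurableSet (f i)) → Pairwise (Function.onFun Disjoint f) →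
      ∀ s : Finset ℕ, ∑ i ∈ s, L (f i) = L (⋃ i ∈ s, f i) := by
    intro f hf hd s
    refine tendsto_nhds_unique (tendsto_finsetSum s fun i _ => hL (f i) (hf i)) ?_
    refine (hL _ (s.measurableSet_biUnion fun i _ => hf i)).congr fun n => ?_
    exact measureReal_biUnion_finset (fun i _ j _ hij => hd hij) fun i _ => hf i
  -- Partial unions exhaust the union for each `μ n`; the limits in `n` and in the partial
  -- unions may be interchanged because the former is uniform.
  have hsum : ∀ (f : ℕ → Set X), (∀ i, MeasurableSet (f i)) → Pairwise (Function.onFun Disjoint f) →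
      HasSum (fun i => L (f i)) (L (⋃ i, f i)) := by
    intro f hf hd
    have hu : TendstoUniformly (fun n (s : Finset ℕ) => (μ n).real (⋃ i ∈ s, f i))
        (fun s => ∑ i ∈ s, L (f i)) atTop := by
      rw [Metric.tendstoUniformly_iff]
      intro δ hδ
      filter_upwards [hε.eventually (gt_mem_nhds hδ)] with n hn s
      rw [hfin f hf hd, dist_comm]
      exact (hbound n _ (s.measurableSet_biUnion fun i _ => hf i)).trans_lt hn
    refine hu.tendsto_of_eventually_tendsto (L := fun n => (μ n).real (⋃ i, f i))
      (Eventually.of_forall fun n => ?_) (hL _ (.iUnion hf))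
    have : HasSum (fun i => (μ n).real (f i)) ((μ n).real (⋃ i, f i)) := by
      have := (μ n).toSignedMeasure.hasSum_of_disjoint_iUnion hf hd
      simpa [Measure.toSignedMeasure_apply_measurable, hf, MeasurableSet.iUnion hf] using this
    refine Tendsto.congr (fun s => ?_) this
    exact (measureReal_biUnion_finset (fun i _ j _ hij => hd hij) fun i _ => hf i).symm
  let π : Measure X := Measure.ofMeasurable (fun A _ => ENNReal.ofReal (L A)) (by simp [hempty])
    fun f hf hd => by
      rw [← (hsum f hf hd).tsum_eq]
      exact ENNReal.ofReal_tsum_of_nonneg (fun i => hnonneg _ (hf i)) (hsum f hf hd).summable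
  have hπ : ∀ A, MeasurableSet A → π A = ENNReal.ofReal (L A) := fun A hA =>
    Measure.ofMeasurable_apply A hA
  refine ⟨π, ⟨by simp [hπ _ .univ, huniv]⟩, fun n A hA => ?_⟩
  rw [measureReal_def, measureReal_def, hπ A hA, ENNReal.toReal_ofReal (hnonneg A hA)]
  exact hbound n A hA

end SetwiseEstimates

/-! ### Harris' theorem -/

section Harris

variable {X : Type*} [MeasurableSpace X]

/-- A function whose oscillation between `x` and `y` is at most `W x + W y` is bounded by `W`
after subtraction of a constant. -/
lemma exists_abs_sub_le_of_sub_le_add {X : Type*} {φ W : X → ℝ}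
    (h : ∀ x y, φ x - φ y ≤ W x + W y) : ∃ c, ∀ x, |φ x - c| ≤ W x := by
  rcases isEmpty_or_nonempty X with hX | hX
  · exact ⟨0, fun x => hX.elim x⟩
  · have hb : ∀ y, ⨆ x, (φ x - W x) ≤ φ y + W y := fun y =>
      ciSup_le fun x => by linarith [h x y]
    have ha : BddAbove (Set.range fun x => φ x - W x) := by
      refine ⟨φ hX.some + W hX.some, ?_⟩
      rintro _ ⟨x, rfl⟩
      linarith [h x hX.some]
    refine ⟨⨆ x, (φ x - W x), fun x => abs_le.2 ⟨?_, ?_⟩⟩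
    · linarith [hb x]
    · linarith [le_ciSup ha x]

lemma real_comp_apply (κ : Kernel X X) [IsMarkovKernel κ] (μ : Measure X) {A : Set X}
    (hA : MeasurableSet A) : (κ ∘ₘ μ).real A = ∫ x, (κ x).real A ∂μ := by
  simp only [measureReal_def]
  rw [Measure.bind_apply hA κ.aemeasurable, integral_toReal (κ.measurable_coe hA).aemeasurable
    (ae_of_all _ fun x => measure_lt_top _ _)]

lemma pow_add_apply_eq_comp (P : Kernel X X) (n m : ℕ) (x : X) :
    (P ^ (n + m)) x = (P ^ n) ∘ₘ ((P ^ m) x) := by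
  rw [Kernel.pow_add, Kernel.comp_apply]

lemma measurable_real_apply (κ : Kernel X X) {A : Set X} (hA : MeasurableSet A) :
    Measurable fun x => (κ x).real A :=
  (κ.measurable_coe hA).ennreal_toReal

lemma integrable_real_apply (κ : Kernel X X) [IsMarkovKernel κ] (μ : Measure X)
    [IsFiniteMeasure μ] {A : Set X} (hA : MeasurableSet A) :
    Integrable (fun x => (κ x).real A) μ :=
  Integrable.of_bound (measurable_real_apply κ hA).aestronglyMeasurable 1
    (ae_of_all _ fun x => by
      rw [Real.norm_eq_abs, abs_of_nonneg measureReal_nonneg]; exact measureReal_le_one)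

/-- One step of the chain contracts the oscillation of functions measured against the weight
`2 + b V x + b V y`.  Where `V x + V y` is large the drift condition gains; where it is small
the common component `η` of `P x` and `P y` cancels.  With `b = a / (4 c)` the additive term of the
drift costs `2 b c = a / 2`, a quarter of the mass `2 a` that cancels, while beyond the threshold
`8 c / β` the gain `β b (V x + V y)` is at least `2 a`, four times that cost. -/
lemma abs_integral_sub_integral_le_contraction {P : Kernel X X} [IsMarkovKernel P] {V : X → ℝ}
    {β c a : ℝ} (hV : ∀ x, 0 ≤ V x) (hβ : 0 < β) (hc : 0 < c) (ha : 0 < a)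
    (hβ1 : β < 1)
    (hdrift : ∀ x, Integrable V (P x) ∧ ∫ y, V y ∂(P x) ≤ (1 - β) * V x + c)
    {η : Measure X} [IsFiniteMeasure η] (haη : a ≤ η.real Set.univ)
    (hη : ∀ x, V x ≤ 8 * c / β → η ≤ P x) {φ : X → ℝ} (hφ : Measurable φ) {C : ℝ}
    (hφC : ∀ x, |φ x| ≤ C) {l : ℝ}
    (hosc : ∀ x y, |φ x - φ y| ≤ l * (2 + a / (4 * c) * V x + a / (4 * c) * V y)) (x y : X) :
    |∫ z, φ z ∂(P x) - ∫ z, φ z ∂(P y)| ≤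
      l * (1 - min (β / 4) (a / 2)) * (2 + a / (4 * c) * V x + a / (4 * c) * V y) := by
  set b := a / (4 * c) with hb
  have hbpos : 0 < b := by positivity
  have hl : 0 ≤ l := by
    have h1 := (abs_nonneg _).trans (hosc x y)
    have h2 : 0 < 2 + b * V x + b * V y := by have := hV x; have := hV y; positivity
    by_contra! hneg
    nlinarith
  obtain ⟨k, hk⟩ := exists_abs_sub_le_of_sub_le_add (φ := φ) (W := fun x => l * (1 + b * V x))
    fun x y => (le_abs_self _).trans ((hosc x y).trans (le_of_eq (by ring)))
  have hint : ∀ (ν : Measure X) [IsFiniteMeasure ν], Integrable φ ν := fun ν _ =>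
    Integrable.of_bound hφ.aestronglyMeasurable C (ae_of_all _ hφC)
  -- Integrating the bound on `φ - k` against a submeasure of `P x`.
  have hsub : ∀ (w : X) (ν : Measure X), ν ≤ P w →
      |∫ z, φ z - k ∂ν| ≤ l * (ν.real Set.univ + b * ∫ z, V z ∂(P w)) := by
    intro w ν hν
    have : IsFiniteMeasure ν := isFiniteMeasure_of_le _ hν
    have hVi : Integrable V ν := (hdrift w).1.mono_measure hν
    calc |∫ z, φ z - k ∂ν| ≤ ∫ z, |φ z - k| ∂ν := abs_integral_le_integral_abs
      _ ≤ ∫ z, l * (1 + b * V z) ∂ν := by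
          refine integral_mono ((hint ν).sub (integrable_const k)).abs ?_ hk
          exact ((integrable_const _).add (hVi.const_mul b)).const_mul l
      _ = l * (ν.real Set.univ + b * ∫ z, V z ∂ν) := by
          rw [integral_const_mul, integral_add (integrable_const _) (hVi.const_mul b),
            integral_const_mul, integral_const, smul_eq_mul, mul_one]
      _ ≤ _ := by
          have := integral_mono_measure hν (ae_of_all _ hV) (hdrift w).1
          gcongr
  have hPk : ∀ w, ∫ z, φ z ∂(P w) = ∫ z, φ z - k ∂(P w) + k := fun w => by
    rw [integral_sub (hint _) (integrable_const k)]; simp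
  have hdelta1 : min (β / 4) (a / 2) ≤ β / 4 := min_le_left _ _
  have hdelta2 : min (β / 4) (a / 2) ≤ a / 2 := min_le_right _ _
  set δ := min (β / 4) (a / 2)
  have hbc : b * c = a / 4 := by rw [hb]; field_simp
  have hdx := mul_le_mul_of_nonneg_left (hdrift x).2 hbpos.le
  have hdy := mul_le_mul_of_nonneg_left (hdrift y).2 hbpos.le
  have hVx := mul_nonneg hbpos.le (hV x)
  have hVy := mul_nonneg hbpos.le (hV y)
  rw [hPk x, hPk y, mul_assoc]
  by_cases hS : V x ≤ 8 * c / β ∧ V y ≤ 8 * c / β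
  · -- Both points lie in the small set, so the common part `η` cancels.
    have hsplit : ∀ w, η ≤ P w →
        ∫ z, φ z - k ∂(P w) = ∫ z, φ z - k ∂(P w - η) + ∫ z, φ z - k ∂η := fun w hw => by
      conv_lhs => rw [← Measure.sub_add_cancel_of_le hw]
      exact integral_add_measure ((hint _).sub (integrable_const k))
        ((hint _).sub (integrable_const k))
    have hmass : ∀ w, η ≤ P w → (P w - η).real Set.univ ≤ 1 - a := fun w hw => by
      have h1 : (P w).real Set.univ = (P w - η).real Set.univ + η.real Set.univ := by
        conv_lhs => rw [← Measure.sub_add_cancel_of_le hw]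
        exact measureReal_add_apply
      rw [probReal_univ] at h1
      linarith
    have hηx := hη x hS.1
    have hηy := hη y hS.2
    have h1 := hsub x (P x - η) Measure.sub_le
    have h2 := hsub y (P y - η) Measure.sub_le
    rw [hsplit x hηx, hsplit y hηy]
    calc _ = |∫ z, φ z - k ∂(P x - η) - ∫ z, φ z - k ∂(P y - η)| := by congr 1; ring
      _ ≤ l * ((P x - η).real Set.univ + b * ∫ z, V z ∂(P x))
          + l * ((P y - η).real Set.univ + b * ∫ z, V z ∂(P y)) :=
        (abs_sub _ _).trans (add_le_add h1 h2)
      _ = l * ((P x - η).real Set.univ + b * ∫ z, V z ∂(P x)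
          + ((P y - η).real Set.univ + b * ∫ z, V z ∂(P y))) := by ring
      _ ≤ _ := by
        refine mul_le_mul_of_nonneg_left ?_ hl
        have := hmass x hηx
        have := hmass y hηy
        nlinarith
  · have h1 := hsub x (P x) le_rfl
    have h2 := hsub y (P y) le_rfl
    rw [probReal_univ] at h1 h2
    -- Here `b (V x + V y)` is at least `2 a / β`.
    have hlarge : 2 * a ≤ β * (b * V x + b * V y) := by
      have h3 : 8 * c / β ≤ V x + V y := by
        rw [not_and_or, not_le, not_le] at hS
        rcases hS with h | h
        · linarith [hV y]
        · linarith [hV x]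
      rw [div_le_iff₀ hβ] at h3
      have := mul_le_mul_of_nonneg_left h3 hbpos.le
      nlinarith
    calc _ = |∫ z, φ z - k ∂(P x) - ∫ z, φ z - k ∂(P y)| := by congr 1; ring
      _ ≤ l * (1 + b * ∫ z, V z ∂(P x)) + l * (1 + b * ∫ z, V z ∂(P y)) :=
        (abs_sub _ _).trans (add_le_add h1 h2)
      _ = l * (1 + b * ∫ z, V z ∂(P x) + (1 + b * ∫ z, V z ∂(P y))) := by ring
      _ ≤ _ := by
        refine mul_le_mul_of_nonneg_left ?_ hl
        nlinarith

/-- Iterating the drift condition bounds the moments of `V` along the chain uniformly in time. -/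
lemma lintegral_pow_apply_le {P : Kernel X X} [IsMarkovKernel P] {V : X → ℝ} {β c : ℝ}
    (hV : ∀ x, 0 ≤ V x) (hVm : Measurable V) (hβ : 0 < β) (hβ1 : β < 1) (hc : 0 < c)
    (hdrift : ∀ x, Integrable V (P x) ∧ ∫ y, V y ∂(P x) ≤ (1 - β) * V x + c) (n : ℕ) (x : X) :
    ∫⁻ y, ENNReal.ofReal (V y) ∂((P ^ n) x) ≤ ENNReal.ofReal (V x + c / β) := by
  have hVm' : Measurable fun y => ENNReal.ofReal (V y) := hVm.ennreal_ofReal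
  induction n with
  | zero =>
    have : (P ^ 0) x = Measure.dirac x := by rw [pow_zero]; exact Kernel.id_apply x
    rw [this, lintegral_dirac' _ hVm']
    exact ENNReal.ofReal_le_ofReal (by have : 0 < c / β := by positivity
                                       linarith)
  | succ n ih =>
    rw [add_comm, pow_add_apply_eq_comp, pow_one,
      Measure.lintegral_bind P.aemeasurable hVm'.aemeasurable]
    calc ∫⁻ y, ∫⁻ z, ENNReal.ofReal (V z) ∂(P y) ∂((P ^ n) x)
        ≤ ∫⁻ y, (ENNReal.ofReal (1 - β) * ENNReal.ofReal (V y) + ENNReal.ofReal c)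
            ∂((P ^ n) x) := by
          refine lintegral_mono fun y => ?_
          rw [← ofReal_integral_eq_lintegral_ofReal (hdrift y).1 (ae_of_all _ hV),
            ← ENNReal.ofReal_mul (by linarith), ← ENNReal.ofReal_add
              (mul_nonneg (by linarith) (hV y)) hc.le]
          exact ENNReal.ofReal_le_ofReal (hdrift y).2
      _ = ENNReal.ofReal (1 - β) * ∫⁻ y, ENNReal.ofReal (V y) ∂((P ^ n) x)
            + ENNReal.ofReal c := by
          rw [lintegral_add_right _ measurable_const, lintegral_const_mul _ hVm',
            lintegral_const, measure_univ, mul_one]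
      _ ≤ ENNReal.ofReal (1 - β) * ENNReal.ofReal (V x + c / β) + ENNReal.ofReal c := by gcongr
      _ = ENNReal.ofReal ((1 - β) * (V x + c / β) + c) := by
          have := hV x
          rw [← ENNReal.ofReal_mul (by linarith), ← ENNReal.ofReal_add
            (mul_nonneg (by linarith) (by positivity)) hc.le]
      _ ≤ ENNReal.ofReal (V x + c / β) := by
          refine ENNReal.ofReal_le_ofReal ?_
          have h1 : β * (c / β) = c := by field_simp
          nlinarith [hV x]

/-- **Harris' theorem**, in the form of Hairer and Mattingly: a Lyapunov function whose sublevel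
sets are small sets in one step gives geometric ergodicity. -/
theorem geometricallyErgodic_of_drift_of_minorization [Nonempty X] {P : Kernel X X}
    [IsMarkovKernel P] {V : X → ℝ} {β c : ℝ} (hV : ∀ x, 0 ≤ V x) (hVm : Measurable V)
    (hβ : 0 < β) (hc : 0 < c) (hβ1 : β < 1)
    (hdrift : ∀ x, Integrable V (P x) ∧ ∫ y, V y ∂(P x) ≤ (1 - β) * V x + c)
    (hsmall : ∀ R, ∃ η : Measure X, IsFiniteMeasure η ∧ η ≠ 0 ∧ ∀ x, V x ≤ R → η ≤ P x) :
    GeometricallyErgodic P V := by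
  obtain ⟨η, _, hη0, hη⟩ := hsmall (8 * c / β)
  have : NeZero η := ⟨hη0⟩
  obtain ⟨a, ha, ha1, haη⟩ : ∃ a : ℝ, 0 < a ∧ a ≤ 1 ∧ a ≤ η.real Set.univ :=
    ⟨min 1 (η.real Set.univ), lt_min one_pos measureReal_univ_pos, min_le_left _ _,
      min_le_right _ _⟩
  obtain ⟨b, hbdef⟩ : ∃ b, b = a / (4 * c) := ⟨_, rfl⟩
  have hb : 0 < b := by rw [hbdef]; positivity
  obtain ⟨r, hrdef⟩ : ∃ r, r = 1 - min (β / 4) (a / 2) := ⟨_, rfl⟩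
  have hr1 : r < 1 := by
    have : 0 < min (β / 4) (a / 2) := lt_min (by positivity) (by positivity)
    linarith
  have hr0 : 0 < r := by
    have := min_le_left (β / 4) (a / 2)
    linarith
  -- Two point masses approach each other.
  have hosc : ∀ n A, MeasurableSet A → ∀ x y,
      |((P ^ n) x).real A - ((P ^ n) y).real A| ≤ r ^ n * (2 + b * V x + b * V y) := by
    intro n A hA
    induction n with
    | zero =>
      intro x y
      have h1 : ∀ w, ((P ^ 0) w).real A ≤ 1 := fun w => measureReal_le_one
      have h2 : ∀ w, 0 ≤ ((P ^ 0) w).real A := fun w => measureReal_nonneg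
      have h3 := mul_nonneg hb.le (hV x)
      have h4 := mul_nonneg hb.le (hV y)
      rw [abs_le, pow_zero, one_mul]
      constructor <;> linarith [h1 x, h1 y, h2 x, h2 y]
    | succ n ih =>
      intro x y
      have h1 : ∀ w, ((P ^ (n + 1)) w).real A = ∫ z, ((P ^ n) z).real A ∂(P w) := fun w => by
        rw [pow_add_apply_eq_comp, real_comp_apply _ _ hA, pow_one]
      rw [h1, h1, pow_succ, hrdef, hbdef]
      refine abs_integral_sub_integral_le_contraction hV hβ hc ha hβ1 hdrift haη hη
        (measurable_real_apply _ hA) (C := 1) (fun w => ?_) (fun x y => ?_) x y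
      · rw [abs_of_nonneg measureReal_nonneg]; exact measureReal_le_one
      · rw [← hrdef, ← hbdef]; exact ih x y
  -- The law at a later time is a mixture of laws at time `n`.
  have hcauchy : ∀ x n m A, MeasurableSet A →
      |((P ^ n) x).real A - ((P ^ (n + m)) x).real A| ≤
        r ^ n * (2 + b * V x + b * (V x + c / β)) := by
    intro x n m A hA
    have hlin := lintegral_pow_apply_le hV hVm hβ hβ1 hc hdrift m x
    have hVi : Integrable V ((P ^ m) x) := by
      refine ⟨hVm.aestronglyMeasurable, ?_⟩
      rw [hasFiniteIntegral_iff_ofReal (ae_of_all _ hV)]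
      exact hlin.trans_lt ENNReal.ofReal_lt_top
    have hVle : ∫ y, V y ∂((P ^ m) x) ≤ V x + c / β := by
      rw [integral_eq_lintegral_of_nonneg_ae (ae_of_all _ hV) hVm.aestronglyMeasurable]
      exact ENNReal.toReal_le_of_le_ofReal (by have := hV x; positivity) hlin
    rw [pow_add_apply_eq_comp, real_comp_apply _ _ hA]
    have h1 : ((P ^ n) x).real A - ∫ y, ((P ^ n) y).real A ∂((P ^ m) x)
        = ∫ y, (((P ^ n) x).real A - ((P ^ n) y).real A) ∂((P ^ m) x) := by
      rw [integral_sub (integrable_const _) (integrable_real_apply _ _ hA)]; simp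
    have hWi : Integrable (fun y => 2 + b * V x + b * V y) ((P ^ m) x) :=
      (integrable_const _).add (hVi.const_mul b)
    rw [h1]
    calc _ ≤ ∫ y, |((P ^ n) x).real A - ((P ^ n) y).real A| ∂((P ^ m) x) :=
          abs_integral_le_integral_abs
      _ ≤ ∫ y, r ^ n * (2 + b * V x + b * V y) ∂((P ^ m) x) :=
          integral_mono ((integrable_const _).sub (integrable_real_apply _ _ hA)).abs
            (hWi.const_mul _) fun y => hosc n A hA x y
      _ = r ^ n * (2 + b * V x + b * ∫ y, V y ∂((P ^ m) x)) := by
          rw [integral_const_mul, integral_add (integrable_const _) (hVi.const_mul b),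
            integral_const_mul, integral_const]; simp
      _ ≤ _ := by gcongr
  have hrn : Tendsto (fun n : ℕ => r ^ n) atTop (𝓝 0) :=
    tendsto_pow_atTop_nhds_zero_of_lt_one hr0.le hr1
  obtain ⟨x₀⟩ := ‹Nonempty X›
  obtain ⟨π, hπ, hπx₀⟩ := exists_isProbabilityMeasure_abs_real_sub_le (fun n => (P ^ n) x₀)
    (ε := fun n => r ^ n * (2 + b * V x₀ + b * (V x₀ + c / β)))
    (by simpa using hrn.mul_const _) (hcauchy x₀)
  have hlim₀ : ∀ A, MeasurableSet A →
      Tendsto (fun n => ((P ^ n) x₀).real A) atTop (𝓝 (π.real A)) := fun A hA => by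
    rw [tendsto_iff_dist_tendsto_zero]
    exact squeeze_zero (fun _ => dist_nonneg) (fun n => hπx₀ n A hA)
      (by simpa using hrn.mul_const _)
  have hlim : ∀ x A, MeasurableSet A →
      Tendsto (fun n => ((P ^ n) x).real A) atTop (𝓝 (π.real A)) := fun x A hA => by
    refine (hlim₀ A hA).congr_dist ?_
    exact squeeze_zero (fun _ => dist_nonneg) (fun n => hosc n A hA x₀ x)
      (by simpa using hrn.mul_const _)
  obtain ⟨κ, hκ, hκdef⟩ : ∃ κ : ℝ, 0 < κ ∧ ∀ x,
      2 + b * V x + b * (V x + c / β) ≤ κ * (1 + V x) := by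
    refine ⟨2 + b * c / β + 2 * b, by positivity, fun x => ?_⟩
    have h1 : 0 < b * c / β := by positivity
    have h2 := hV x
    have h3 : b * (c / β) = b * c / β := by ring
    nlinarith [mul_nonneg h1.le h2]
  have hpoint : ∀ x n A, MeasurableSet A →
      |((P ^ n) x).real A - π.real A| ≤ κ * r ^ n * (1 + V x) := by
    intro x n A hA
    have h1 : Tendsto (fun m => |((P ^ n) x).real A - ((P ^ (n + m)) x).real A|) atTop
        (𝓝 |((P ^ n) x).real A - π.real A|) := by
      refine (tendsto_const_nhds.sub ((hlim x A hA).comp ?_)).abs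
      exact tendsto_atTop_mono (fun m => Nat.le_add_left m n) tendsto_id
    refine (le_of_tendsto' h1 fun m => hcauchy x n m A hA).trans ?_
    calc _ ≤ r ^ n * (κ * (1 + V x)) := by gcongr; exact hκdef x
      _ = _ := by ring
  -- The bound by `1` keeps the right-hand side integrable for every initial law.
  have hmix : ∀ (μ : Measure X) [IsProbabilityMeasure μ] (n : ℕ) A, MeasurableSet A →
      |((P ^ n) ∘ₘ μ).real A - π.real A| ≤ ∫ x, min 1 (κ * r ^ n * (1 + V x)) ∂μ := by
    intro μ _ n A hA
    have h1 : ((P ^ n) ∘ₘ μ).real A - π.real A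
        = ∫ x, (((P ^ n) x).real A - π.real A) ∂μ := by
      rw [real_comp_apply _ _ hA, integral_sub (integrable_real_apply _ _ hA)
        (integrable_const _)]; simp
    rw [h1]
    refine abs_integral_le_integral_abs.trans (integral_mono
      ((integrable_real_apply _ _ hA).sub (integrable_const _)).abs ?_ fun x => le_min ?_
        (hpoint x n A hA))
    · refine Integrable.of_bound (by fun_prop) 1 (ae_of_all _ fun x => ?_)
      have := hV x
      rw [Real.norm_eq_abs, abs_of_nonneg (le_min zero_le_one (by positivity))]
      exact min_le_left _ _
    · have h1 : ((P ^ n) x).real A ≤ 1 := measureReal_le_one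
      have h2 : 0 ≤ ((P ^ n) x).real A := measureReal_nonneg
      have h3 : π.real A ≤ 1 := measureReal_le_one
      have h4 : 0 ≤ π.real A := measureReal_nonneg
      rw [abs_le]
      constructor <;> linarith
  have hmixlim : ∀ (μ : Measure X) [IsProbabilityMeasure μ],
      Tendsto (fun n : ℕ => ∫ x, min 1 (κ * r ^ n * (1 + V x)) ∂μ) atTop (𝓝 0) := by
    intro μ _
    have := tendsto_integral_of_dominated_convergence (μ := μ)
      (F := fun (n : ℕ) x => min 1 (κ * r ^ n * (1 + V x))) (f := fun _ => 0) (fun _ => (1 : ℝ))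
      (fun n => by fun_prop) (integrable_const _)
      (fun n => ae_of_all _ fun x => by
        have := hV x
        rw [Real.norm_eq_abs, abs_of_nonneg (le_min zero_le_one (by positivity))]
        exact min_le_left _ _)
      (ae_of_all _ fun x => by
        have h1 : Tendsto (fun n : ℕ => κ * r ^ n * (1 + V x)) atTop (𝓝 0) := by
          simpa using (hrn.const_mul κ).mul_const (1 + V x)
        simpa using (tendsto_const_nhds (x := (1 : ℝ))).min h1)
    simpa using this
  have hmixV : ∀ (μ : Measure X) [IsProbabilityMeasure μ], Integrable V μ → ∀ n : ℕ,
      ∫ x, min 1 (κ * r ^ n * (1 + V x)) ∂μ ≤ κ * r ^ n * (1 + ∫ x, V x ∂μ) := by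
    intro μ _ hVi n
    have h1 : Integrable (fun x => κ * r ^ n * (1 + V x)) μ :=
      ((integrable_const 1).add hVi).const_mul _
    calc _ ≤ ∫ x, κ * r ^ n * (1 + V x) ∂μ := by
          refine integral_mono_of_nonneg (ae_of_all _ fun x => ?_) h1
            (ae_of_all _ fun x => min_le_right _ _)
          have := hV x
          exact le_min zero_le_one (by positivity)
      _ = _ := by
          rw [integral_const_mul, integral_add (integrable_const _) hVi]; simp
  have hinv : P.Invariant π := by
    change P ∘ₘ π = π
    ext A hA
    refine (measureReal_eq_measureReal_iff).1 ?_
    have h1 : Tendsto (fun n => ∫ y, (P y).real A ∂((P ^ n) x₀)) atTop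
        (𝓝 (∫ y, (P y).real A ∂π)) := by
      rw [tendsto_iff_dist_tendsto_zero]
      refine squeeze_zero (fun _ => dist_nonneg) (fun n => ?_)
        (by simpa using hrn.mul_const (2 + b * V x₀ + b * (V x₀ + c / β)))
      exact abs_integral_sub_integral_le (hπx₀ n) (measurable_real_apply P hA)
        (fun _ => measureReal_nonneg) fun _ => measureReal_le_one
    rw [real_comp_apply _ _ hA]
    refine tendsto_nhds_unique h1 (((hlim₀ A hA).comp (tendsto_add_atTop_nat 1)).congr fun n => ?_)
    rw [Function.comp_apply, add_comm, pow_add_apply_eq_comp, real_comp_apply _ _ hA, pow_one]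
  refine ⟨π, hπ, hinv, ?_, ⟨r, 2 * κ, hr0, hr1, by positivity, ?_, ?_⟩, ?_⟩
  · intro π' _ hπ'
    have hpow : ∀ n : ℕ, (P ^ n) ∘ₘ π' = π' := fun n => by
      induction n with
      | zero => exact Measure.bind_dirac
      | succ n ih =>
        rw [pow_succ]
        change ((P ^ n) ∘ₖ P) ∘ₘ π' = π'
        rw [← Measure.comp_assoc, hπ'.def, ih]
    ext A hA
    refine (measureReal_eq_measureReal_iff).1 (sub_eq_zero.1 (abs_nonpos_iff.1 ?_))
    refine ge_of_tendsto' (hmixlim π') fun n => ?_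
    have h1 := hmix π' n A hA
    rwa [hpow n] at h1
  · intro μ _ n
    by_cases hVi : Integrable V μ
    · refine (tvNorm_le_of_forall_abs_real_sub_le fun A hA =>
        (hmix μ n A hA).trans (hmixV μ hVi n)).trans (le_of_eq ?_)
      have h0 : 0 ≤ ∫ x, V x ∂μ := integral_nonneg hV
      rw [← ofReal_integral_eq_lintegral_ofReal hVi (ae_of_all _ hV), ← ENNReal.ofReal_one,
        ← ENNReal.ofReal_add zero_le_one h0, ← ENNReal.ofReal_mul (by positivity)]
      congr 1; ring
    · have htop : ∫⁻ x, ENNReal.ofReal (V x) ∂μ = ∞ := by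
        by_contra hne
        exact hVi ⟨hVm.aestronglyMeasurable, by
          rw [hasFiniteIntegral_iff_ofReal (ae_of_all _ hV)]; exact lt_top_iff_ne_top.2 hne⟩
      rw [htop, add_top, ENNReal.mul_top (by
        rw [Ne, ENNReal.ofReal_eq_zero, not_le]; positivity)]
      exact le_top
  · intro μ ν _ _ hμ hν
    have h1 : 0 ≤ ∫ x, V x ∂μ := integral_nonneg hV
    have h2 : 0 ≤ ∫ x, V x ∂ν := integral_nonneg hV
    refine ⟨2 * κ * (2 + ∫ x, V x ∂μ + ∫ x, V x ∂ν), by positivity, fun n => ?_⟩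
    refine (tvNorm_le_of_forall_abs_real_sub_le
      (ε := κ * r ^ n * (1 + ∫ x, V x ∂μ) + κ * r ^ n * (1 + ∫ x, V x ∂ν))
      fun A hA => ?_).trans (le_of_eq (by congr 1; ring))
    refine (abs_sub_le _ (π.real A) _).trans (add_le_add ?_ ?_)
    · exact (hmix μ n A hA).trans (hmixV μ hμ n)
    · rw [abs_sub_comm]; exact (hmix ν n A hA).trans (hmixV ν hν n)
  · intro μ _
    refine tendsto_of_tendsto_of_tendsto_of_le_of_le tendsto_const_nhds ?_
      (fun _ => zero_le) fun n => tvNorm_le_of_forall_abs_real_sub_le (hmix μ n)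
    simpa using ENNReal.tendsto_ofReal ((hmixlim μ).const_mul 2)

end Harris
/-! ### Minorization for the signal-ensemble process -/

section Minorization

lemma measure_pi_mono {ι : Type*} [Fintype ι] {X : ι → Type*} [∀ i, MeasurableSpace (X i)]
    {μ ν : ∀ i, Measure (X i)} [∀ i, SigmaFinite (μ i)] [∀ i, SigmaFinite (ν i)]
    (h : ∀ i, μ i ≤ ν i) : Measure.pi μ ≤ Measure.pi ν := by
  have h1 : (Measure.pi μ).toOuterMeasure ≤ OuterMeasure.pi fun i => (ν i).toOuterMeasure := by
    rw [OuterMeasure.le_pi]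
    intro s _
    change Measure.pi μ _ ≤ ∏ i, ν i (s i)
    rw [Measure.pi_pi]
    exact Finset.prod_le_prod' fun i _ => h i (s i)
  refine Measure.le_iff.2 fun s hs => ?_
  rw [Measure.pi_def (μ := ν), toMeasure_apply _ _ hs]
  exact h1 s

variable {d q K : ℕ} (M : FilterModel d q)

lemma trace_noiseCov_nonneg (u : EuclideanSpace ℝ (Fin d)) : 0 ≤ (M.noiseCov u).trace :=
  Finset.sum_nonneg fun i _ => integral_nonneg fun z => mul_self_nonneg (z i)

lemma exists_norm_drift_le (hkin : M.KineticEnergyPrinciple) (R : ℝ) :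
    ∃ B, 0 ≤ B ∧ ∀ u, ‖u‖ ≤ R → ‖M.Ψ u‖ ≤ B := by
  obtain ⟨β, c, hβ, hβ1, hc, h⟩ := hkin
  refine ⟨1 + R ^ 2 + c, by positivity, fun u hu => ?_⟩
  have h1 := h u
  have h2 := trace_noiseCov_nonneg M u
  have h3 : ‖u‖ ^ 2 ≤ R ^ 2 := pow_le_pow_left₀ (norm_nonneg u) hu 2
  nlinarith [sq_nonneg (‖M.Ψ u‖ - 1), sq_nonneg ‖u‖]

lemma signalKernel_apply (u : EuclideanSpace ℝ (Fin d)) :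
    M.signalKernel u = (M.noise u).map fun z => M.Ψ u + z := by
  rw [FilterModel.signalKernel, Kernel.map_apply _ (by fun_prop), Kernel.prod_apply,
    Kernel.deterministic_apply, Measure.dirac_prod, Measure.map_map (by fun_prop) (by fun_prop)]
  rfl

/-- From any bounded set the signal kernel dominates a fixed multiple of Lebesgue measure on the
unit ball: `Ψ` is bounded there, so the noise is only asked to charge a ball large enough to contain
all translates of the unit ball by `-Ψ u`. -/
lemma exists_le_signalKernel (hkin : M.KineticEnergyPrinciple) (hnoise : M.NondegenerateNoise)
    {R : ℝ} (hR : 0 < R) :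
    ∃ η : Measure (EuclideanSpace ℝ (Fin d)), IsFiniteMeasure η ∧ η ≠ 0 ∧
      ∀ u, ‖u‖ ≤ R → η ≤ M.signalKernel u := by
  obtain ⟨B, hB, hΨ⟩ := exists_norm_drift_le M hkin R
  obtain ⟨α, hα, h⟩ := hnoise R (1 + B) hR (by linarith)
  have hball : volume (Metric.closedBall (0 : EuclideanSpace ℝ (Fin d)) 1) < ∞ :=
    measure_closedBall_lt_top
  have : IsFiniteMeasure (volume.restrict
    (Metric.closedBall (0 : EuclideanSpace ℝ (Fin d)) 1)) := ⟨by simpa using hball⟩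
  refine ⟨ENNReal.ofReal α • volume.restrict (Metric.closedBall 0 1),
    Measure.smul_finite _ ENNReal.ofReal_ne_top, fun h0 => ?_, fun u hu => ?_⟩
  · have h1 := congrArg (fun μ : Measure (EuclideanSpace ℝ (Fin d)) => μ Set.univ) h0
    have h2 : 0 < volume (Metric.closedBall (0 : EuclideanSpace ℝ (Fin d)) 1) :=
      Metric.measure_closedBall_pos _ _ one_pos
    simp only [Measure.smul_apply, Measure.restrict_apply_univ, smul_eq_mul, Measure.coe_zero,
      Pi.zero_apply, mul_eq_zero, ENNReal.ofReal_eq_zero] at h1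
    rcases h1 with h1 | h1
    · linarith
    · exact h2.ne' h1
  · rw [signalKernel_apply]
    refine Measure.le_iff.2 fun A hA => ?_
    have hf : Measurable fun z : EuclideanSpace ℝ (Fin d) => M.Ψ u + z := by fun_prop
    rw [Measure.map_apply hf hA]
    refine le_trans ?_ (h u hu _)
    rw [Measure.smul_apply, Measure.smul_apply, Measure.restrict_apply hA,
      Measure.restrict_apply (hf hA)]
    refine smul_le_smul_of_nonneg_left ?_ zero_le
    rw [← measure_preimage_add volume (M.Ψ u) (A ∩ Metric.closedBall 0 1)]
    refine measure_mono fun z hz => ⟨hz.1, ?_⟩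
    have h1 : ‖M.Ψ u + z‖ ≤ 1 := mem_closedBall_zero_iff.1 hz.2
    rw [mem_closedBall_zero_iff]
    calc ‖z‖ = ‖M.Ψ u + z - M.Ψ u‖ := by rw [add_sub_cancel_left]
      _ ≤ ‖M.Ψ u + z‖ + ‖M.Ψ u‖ := norm_sub_le _ _
      _ ≤ 1 + B := add_le_add h1 (hΨ u hu)

/-- Bounded sets are small sets of the signal-ensemble process.  Signal, ensemble members and
observation noise are drawn independently, so the forecast kernel dominates a fixed product
measure, and the update map pushes this domination forward. -/
lemma exists_le_etkfKernel (hkin : M.KineticEnergyPrinciple) (hnoise : M.NondegenerateNoise)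
    {R : ℝ} (hR : 0 < R) :
    ∃ η : Measure (State d K), IsFiniteMeasure η ∧ η ≠ 0 ∧
      ∀ x, ‖x‖ ≤ R → η ≤ M.etkfKernel K x := by
  obtain ⟨η₀, _, h0, h⟩ := exists_le_signalKernel M hkin hnoise hR
  have hobs : Measurable fun p : State d K × EuclideanSpace ℝ (Fin q) =>
      (p.1, M.H.toEuclideanLin p.1.1 + p.2) := by fun_prop
  have hupd := measurable_etkfUpdate (K := K) M.H
  refine ⟨(((η₀.prod (Measure.pi fun _ : Fin K => η₀)).prod M.obsNoise).map
    fun p => (p.1, M.H.toEuclideanLin p.1.1 + p.2)).map (etkfUpdate M.H), inferInstance,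
    fun hz => ?_, fun x hx => ?_⟩
  · rw [Measure.map_eq_zero_iff hupd.aemeasurable,
      Measure.map_eq_zero_iff hobs.aemeasurable] at hz
    have h1 := congrArg (fun μ => μ Set.univ) hz
    have h2 : η₀ Set.univ ≠ 0 := fun h => h0 (Measure.measure_univ_eq_zero.1 h)
    simp [← Set.univ_prod_univ, Measure.prod_prod, Measure.pi_univ, h2] at h1
  · rw [FilterModel.etkfKernel, Kernel.map_apply _ hupd, FilterModel.forecastKernel,
      Kernel.map_apply _ hobs, Kernel.prod_apply, Kernel.parallelComp_apply, Kernel.const_apply]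
    refine Measure.map_mono (Measure.map_mono (Measure.prod_mono (Measure.prod_mono ?_ ?_) le_rfl)
      hobs) hupd
    · exact h _ ((norm_fst_le x).trans hx)
    · exact measure_pi_mono fun k => h _ ((norm_le_pi_norm x.2 k).trans ((norm_snd_le x).trans hx))

end Minorization
end EnsembleFilter

open EnsembleFilter
theorem mainTheorem6 {d q K : ℕ} (hK : 2 ≤ K) (M : FilterModel d q)
    (hkin : M.KineticEnergyPrinciple) (hnoise : M.NondegenerateNoise)
    (𝓔 : State d K → ℝ) (hLyap : IsStrongLyapunov (M.etkfKernel K) 𝓔) :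
    GeometricallyErgodic (M.etkfKernel K) 𝓔 := by
  obtain ⟨h0, hcpt, β, c, hβ, hc, hdrift⟩ := hLyap
  -- The drift condition only weakens when `β`, which may exceed `1`, is decreased.
  refine geometricallyErgodic_of_drift_of_minorization (β := min β (1 / 2)) (c := c) h0
    (measurable_of_Iic fun a => (hcpt a).isClosed.measurableSet)
    (lt_min hβ (by norm_num)) hc ((min_le_right _ _).trans_lt (by norm_num))
    (fun x => ⟨(hdrift x).1, (hdrift x).2.trans ?_⟩) fun R => ?_
  · have := mul_le_mul_of_nonneg_right (min_le_left β (1 / 2)) (h0 x)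
    linarith
  · obtain ⟨B, hB, hBR⟩ := (hcpt R).isBounded.exists_pos_norm_le
    obtain ⟨η, hη, hη0, h⟩ := exists_le_etkfKernel (K := K) M hkin hnoise hB
    exact ⟨η, hη, hη0, fun x hx => h x (hBR x hx)⟩
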